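/- Let $G=(V,E)$ be a finite, undirected, connected graph without loops or parallel edges, with $n=|V|\ge 2$ vertices. Write $d_x$ for the degree of $x\in V$, $d_{\min}$ for the minimum degree and $d_{\rm avg}$ for the average degree. Let $P$ be the transition matrix of lazy random walk on $G$, i.e. $P(x,x)=\frac12$, $P(x,y)=\frac1{2d_x}$ if $xy\in E$, and $P(x,y)=0$ otherwise; let $\pi(x)=\frac{d_x}{d_{\rm avg}\,n}$ be its stationary distribution. Let $1=\lambda_1>\lambda_2\ge\dots\ge\lambda_n\ge 0$ be the eigenvalues of $P$, with multiplicity, and let $t_{\rm rel}=(1-\lambda_2)^{-1}$ be the relaxation time. Then for every $x\in V$ and every integer $t\ge 0$, \[ P^t(x,x)-\pi(x)\;\le\;\frac{10\,d_x}{d_{\min}}\,\min\left\{\frac{1}{\sqrt{t+1}},\;\frac{\sqrt{t_{\rm rel}+1}}{t+1}\right\}. \] -/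

import Mathlib

noncomputable section

namespace LazyWalk

variable {V : Type*} [Fintype V] [DecidableEq V]

/-- Transition matrix of lazy random walk on `G`. -/
def transitionMatrix (G : SimpleGraph V) [DecidableRel G.Adj] : Matrix V V ℝ :=
  Matrix.of fun x y =>
    if y = x then 1 / 2 else if G.Adj x y then 1 / (2 * (G.degree x : ℝ)) else 0

/-- Average degree of `G`. -/
def avgDegree (G : SimpleGraph V) [DecidableRel G.Adj] : ℝ :=
  (∑ x, (G.degree x : ℝ)) / (Fintype.card V : ℝ)

/-- Stationary distribution `π(x) = d_x / (d_avg n)`. -/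
def stationary (G : SimpleGraph V) [DecidableRel G.Adj] (x : V) : ℝ :=
  (G.degree x : ℝ) / (avgDegree G * (Fintype.card V : ℝ))

/-- The real eigenvalues of a matrix, with algebraic multiplicity, in decreasing order. -/
def eigenvalueList (P : Matrix V V ℝ) : List ℝ :=
  P.charpoly.roots.sort (· ≥ ·)

/-- The second largest eigenvalue `λ₂`, counted with multiplicity
(the list is indexed from `0`; the default value `0` is used only for lists of length `< 2`). -/
def lambdaTwo (P : Matrix V V ℝ) : ℝ :=
  (eigenvalueList P).getD 1 0

/-- Relaxation time `t_rel = (1 - λ₂)⁻¹` of lazy random walk on `G`. -/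
def relaxationTime (G : SimpleGraph V) [DecidableRel G.Adj] : ℝ :=
  (1 - lambdaTwo (transitionMatrix G))⁻¹

end LazyWalk

end

/-! Divide the excess return probability by `d_x`: a(n) = (P^n(x,x) - π(x)) / d_x is the value at x
of the centred density f_n of the walk. Reversibility gives ⟨f_s, f_t⟩ = a(s+t) in the degree inner
product, so a(2s) - a(2s+1) is the Dirichlet form of f_s (`centredDensity_sub_succ`).

A Nash-type inequality bounds that form below. The function f_s has mean zero, hence is nonpositive
somewhere, and its positive part has mass at most 1. With δ the minimum degree, such a function
satisfies gradSq ≥ δ² f_s(x)³ / 50 (`nash_inequality`): on a geodesic towards a nonpositive value,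
either one vertex sees a steep drop to its neighbours, or f_s is large near so many vertices that
the mass bound keeps the descent short.

By laziness the spectrum is nonnegative, so a is decreasing and convex (`exists_spectral_return`).
This turns the bound on even decrements into h(n)³/200 ≤ h(n) - h(n+1) for h = δa and all n, whence
h(n) ≤ 10/√(n+1). For the other bound, run this estimate up to time about t_rel, then use decay by
the factor λ₂ per step (`le_sqrt_div_of_geometric_decay`). -/

namespace LazyWalk

open Finset

/-! ### Geodesics and a Nash-type inequality. -/

section Nash

variable {V : Type*}

/-- A geodesic between two vertices, as a sequence of vertices. -/
theorem exists_geodesic {G : SimpleGraph V} (hconn : G.Connected) (x y : V) :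
    ∃ v : ℕ → V, v 0 = x ∧ v (G.dist x y) = y ∧
      (∀ i < G.dist x y, G.Adj (v i) (v (i + 1))) ∧ ∀ i ≤ G.dist x y, G.dist x (v i) = i := by
  obtain ⟨p, hp⟩ := hconn.exists_walk_length_eq_dist x y
  refine ⟨p.getVert, p.getVert_zero, by rw [← hp]; exact p.getVert_length,
    fun i hi => p.adj_getVert_succ (hp ▸ hi), fun i hi => ?_⟩
  have h1 := SimpleGraph.dist_le (p.take i)
  have h2 := SimpleGraph.dist_le (p.drop i)
  have h3 := hconn.dist_triangle (u := x) (v := p.getVert i) (w := y)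
  rw [SimpleGraph.Walk.take_length] at h1
  rw [SimpleGraph.Walk.drop_length] at h2
  omega

variable (G : SimpleGraph V) [DecidableRel G.Adj]

theorem adjMatrix_nonneg (y z : V) : 0 ≤ G.adjMatrix ℝ y z := by
  rw [SimpleGraph.adjMatrix_apply]; split_ifs <;> norm_num

theorem adjMatrix_comm (y z : V) : G.adjMatrix ℝ y z = G.adjMatrix ℝ z y := by
  simp [SimpleGraph.adjMatrix_apply, G.adj_comm]

/-- Each vertex is adjacent to at most three vertices of a geodesic. -/
theorem sum_adjMatrix_geodesic_le {G : SimpleGraph V} [DecidableRel G.Adj] (hconn : G.Connected)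
    (x : V) (v : ℕ → V) (r : ℕ) (hdist : ∀ i < r, G.dist x (v i) = i) (z : V) :
    ∑ i ∈ range r, G.adjMatrix ℝ (v i) z ≤ 3 := by
  have h1 : ∑ i ∈ range r, G.adjMatrix ℝ (v i) z =
      (((range r).filter fun i => G.Adj (v i) z).card : ℝ) := by
    simp [SimpleGraph.adjMatrix_apply]
  -- By the triangle inequality, a neighbour of z has distance from x within one of that of z, and
  -- the distance determines i.
  have h2 : ((range r).filter fun i => G.Adj (v i) z) ⊆
      Icc (G.dist x z - 1) (G.dist x z + 1) := by
    intro i hi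
    rw [mem_filter, mem_range] at hi
    have hi1 := hdist i hi.1
    have e1 := hconn.dist_triangle (u := x) (v := v i) (w := z)
    have e2 := hconn.dist_triangle (u := x) (v := z) (w := v i)
    rw [SimpleGraph.dist_eq_one_iff_adj.2 hi.2] at e1
    rw [SimpleGraph.dist_eq_one_iff_adj.2 hi.2.symm] at e2
    rw [mem_Icc]; omega
  have h3 := card_le_card h2
  rw [Nat.card_Icc] at h3
  rw [h1]
  have h4 : ((range r).filter fun i => G.Adj (v i) z).card ≤ 3 := by omega
  exact_mod_cast h4

variable [Fintype V]

/-- The sum of squared differences of `f` over ordered pairs of adjacent vertices. -/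
def gradSq (f : V → ℝ) : ℝ :=
  ∑ y, ∑ z, G.adjMatrix ℝ y z * (f y - f z) ^ 2

theorem sum_adjMatrix (y : V) : ∑ z, G.adjMatrix ℝ y z = G.degree y := by
  simp [SimpleGraph.adjMatrix_apply, ← SimpleGraph.card_neighborFinset_eq_degree,
    SimpleGraph.neighborFinset_eq_filter]

theorem sum_adjMatrix_mul_sq (f : V → ℝ) :
    ∑ y, ∑ z, G.adjMatrix ℝ y z * f z ^ 2 = ∑ y, G.degree y * f y ^ 2 := by
  rw [sum_comm]
  refine sum_congr rfl fun z _ => ?_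
  rw [← sum_mul, ← sum_adjMatrix]
  simp_rw [adjMatrix_comm G z]

theorem vertex_le_gradSq (f : V → ℝ) (y : V) :
    ∑ z, G.adjMatrix ℝ y z * (f y - f z) ^ 2 ≤ gradSq G f :=
  Finset.single_le_sum (f := fun y => ∑ z, G.adjMatrix ℝ y z * (f y - f z) ^ 2)
    (fun y _ => sum_nonneg fun z _ => mul_nonneg (adjMatrix_nonneg G y z) (sq_nonneg _))
    (mem_univ y)

theorem sq_sum_adjMatrix_le (f : V → ℝ) (y : V) :
    (∑ z, G.adjMatrix ℝ y z * (f y - f z)) ^ 2 ≤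
      G.degree y * ∑ z, G.adjMatrix ℝ y z * (f y - f z) ^ 2 := by
  rw [← sum_adjMatrix]
  refine Finset.sum_sq_le_sum_mul_sum_of_sq_le_mul _ (fun z _ => adjMatrix_nonneg G y z)
    (fun z _ => mul_nonneg (adjMatrix_nonneg G y z) (sq_nonneg _)) fun z _ => le_of_eq (by ring)

/-- Cauchy–Schwarz along the path. Injectivity makes the starting points of the steps distinct, so
each step is charged to a different row of `gradSq`. -/
theorem path_le_gradSq (f : V → ℝ) (v : ℕ → V) (r : ℕ)
    (hadj : ∀ i < r, G.Adj (v i) (v (i + 1))) (hinj : Set.InjOn v (range r : Finset ℕ)) :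
    (f (v 0) - f (v r)) ^ 2 ≤ r * gradSq G f := by
  classical
  have h1 : f (v 0) - f (v r) = ∑ i ∈ range r, (f (v i) - f (v (i + 1))) :=
    (Finset.sum_range_sub' (fun i => f (v i)) r).symm
  have h2 : (∑ i ∈ range r, (f (v i) - f (v (i + 1)))) ^ 2 ≤
      r * ∑ i ∈ range r, (f (v i) - f (v (i + 1))) ^ 2 := by
    simpa using sq_sum_le_card_mul_sum_sq (s := range r) (f := fun i => f (v i) - f (v (i + 1)))
  rw [h1]
  refine h2.trans (mul_le_mul_of_nonneg_left ?_ (Nat.cast_nonneg r))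
  have hnn : ∀ y z, 0 ≤ G.adjMatrix ℝ y z * (f y - f z) ^ 2 :=
    fun y z => mul_nonneg (adjMatrix_nonneg G y z) (sq_nonneg _)
  calc ∑ i ∈ range r, (f (v i) - f (v (i + 1))) ^ 2
      ≤ ∑ i ∈ range r, ∑ z, G.adjMatrix ℝ (v i) z * (f (v i) - f z) ^ 2 := by
        refine sum_le_sum fun i hi => ?_
        have := Finset.single_le_sum
          (f := fun z => G.adjMatrix ℝ (v i) z * (f (v i) - f z) ^ 2)
          (fun z _ => hnn _ z) (mem_univ (v (i + 1)))
        simpa [SimpleGraph.adjMatrix_apply, hadj i (mem_range.1 hi)] using this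
    _ = ∑ y ∈ (range r).image v, ∑ z, G.adjMatrix ℝ y z * (f y - f z) ^ 2 :=
        (Finset.sum_image (f := fun y => ∑ z, G.adjMatrix ℝ y z * (f y - f z) ^ 2) hinj).symm
    _ ≤ gradSq G f :=
        sum_le_sum_of_subset_of_nonneg (subset_univ _)
          fun y _ _ => sum_nonneg fun z _ => hnn y z

/-- A Nash-type inequality: a function of bounded positive mass that is large at `x` and
nonpositive somewhere has a large gradient. -/
theorem nash_inequality {G : SimpleGraph V} [DecidableRel G.Adj] (hconn : G.Connected)
    (f : V → ℝ) (x y : V) (hx : 0 < f x) (hy : f y ≤ 0) {δ : ℝ} (hδ : 0 < δ)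
    (hdeg : ∀ z, δ ≤ G.degree z) (hmass : ∑ z, G.degree z * max (f z) 0 ≤ 1)
    (hsmall : δ * f x ≤ 1) :
    δ ^ 2 * f x ^ 3 / 50 ≤ gradSq G f := by
  obtain ⟨v, hv0, hvR, hadj, hdist⟩ := exists_geodesic hconn x y
  set R := G.dist x y
  set ρ := f x with hρ
  have hex : ∃ i, f (v i) < ρ / 2 := ⟨R, by rw [hvR]; linarith⟩
  classical
  -- r is the first time the geodesic sees a value below half of f x.
  obtain ⟨r, hr, hmin⟩ : ∃ r, f (v r) < ρ / 2 ∧ ∀ i < r, ρ / 2 ≤ f (v i) :=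
    ⟨Nat.find hex, Nat.find_spec hex, fun i hi => not_lt.1 (Nat.find_min hex hi)⟩
  have hrR : r ≤ R := by
    by_contra hc
    have := hmin R (not_le.1 hc)
    rw [hvR] at this; linarith
  -- If some vertex before time r has neighbours averaging at most ρ/4, its own edges suffice
  -- (constant 1/16). Otherwise r ≤ 12/(δ²ρ), and the drop along the path gives 1/48.
  by_cases hA : ∃ i < r, ∑ z, G.adjMatrix ℝ (v i) z * f z ≤ G.degree (v i) * (ρ / 4)
  · obtain ⟨i, hi, hsum⟩ := hA
    have h1 := sq_sum_adjMatrix_le G f (v i)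
    have h2 := vertex_le_gradSq G f (v i)
    have h3 : ∑ z, G.adjMatrix ℝ (v i) z * (f (v i) - f z) =
        G.degree (v i) * f (v i) - ∑ z, G.adjMatrix ℝ (v i) z * f z := by
      rw [← sum_adjMatrix, sum_mul, ← sum_sub_distrib]
      exact sum_congr rfl fun z _ => by ring
    have hd := hdeg (v i)
    set D : ℝ := (G.degree (v i) : ℝ)
    have hD : 0 < D := hδ.trans_le hd
    have h4 : D * (ρ / 4) ≤ ∑ z, G.adjMatrix ℝ (v i) z * (f (v i) - f z) := by
      rw [h3]; nlinarith [hmin i hi]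
    have h5 : (D * (ρ / 4)) ^ 2 ≤ D * gradSq G f :=
      (pow_le_pow_left₀ (by positivity) h4 2).trans
        (h1.trans (mul_le_mul_of_nonneg_left h2 hD.le))
    have h6 : D * (ρ ^ 2 / 16) ≤ gradSq G f := by
      refine le_of_mul_le_mul_left ?_ hD
      linarith [show D * (D * (ρ ^ 2 / 16)) = (D * (ρ / 4)) ^ 2 by ring]
    have h7 : δ * (ρ ^ 2 / 16) ≤ D * (ρ ^ 2 / 16) :=
      mul_le_mul_of_nonneg_right hd (by positivity)
    have h8 : δ * ρ ^ 2 * (δ * ρ) ≤ δ * ρ ^ 2 * 1 :=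
      mul_le_mul_of_nonneg_left hsmall (by positivity)
    have h9 : 0 < δ * ρ ^ 2 := by positivity
    linarith [show δ ^ 2 * ρ ^ 3 = δ * ρ ^ 2 * (δ * ρ) by ring]
  · push Not at hA
    have hpos : ∑ z, max (f z) 0 ≤ 1 / δ := by
      rw [le_div_iff₀ hδ, sum_mul]
      refine le_trans (sum_le_sum fun z _ => ?_) hmass
      rw [mul_comm]
      exact mul_le_mul_of_nonneg_right (hdeg z) (le_max_right _ _)
    -- Every vertex before time r has neighbours averaging more than ρ/4, while each z is counted at
    -- most three times; the positive mass thus bounds r.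
    have hcount : r * (δ * (ρ / 4)) ≤ 3 * (1 / δ) := by
      calc r * (δ * (ρ / 4)) = ∑ i ∈ range r, δ * (ρ / 4) := by simp
        _ ≤ ∑ i ∈ range r, ∑ z, G.adjMatrix ℝ (v i) z * max (f z) 0 := by
          refine sum_le_sum fun i hi => ?_
          calc δ * (ρ / 4) ≤ G.degree (v i) * (ρ / 4) :=
                mul_le_mul_of_nonneg_right (hdeg _) (by positivity)
            _ ≤ ∑ z, G.adjMatrix ℝ (v i) z * f z := (hA i (mem_range.1 hi)).le
            _ ≤ _ := sum_le_sum fun z _ =>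
                mul_le_mul_of_nonneg_left (le_max_left _ _) (adjMatrix_nonneg G _ _)
        _ = ∑ z, (∑ i ∈ range r, G.adjMatrix ℝ (v i) z) * max (f z) 0 := by
          rw [sum_comm]; exact sum_congr rfl fun z _ => (sum_mul _ _ _).symm
        _ ≤ ∑ z, 3 * max (f z) 0 := sum_le_sum fun z _ =>
          mul_le_mul_of_nonneg_right
            (sum_adjMatrix_geodesic_le hconn x v r (fun i hi => hdist i (hi.le.trans hrR)) z)
            (le_max_right _ _)
        _ ≤ 3 * (1 / δ) := by rw [← mul_sum]; linarith
    have hinj : Set.InjOn v (range r : Finset ℕ) := by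
      intro i hi j hj hij
      have hi' : i < r := by simpa using hi
      have hj' : j < r := by simpa using hj
      rw [← hdist i (hi'.le.trans hrR), ← hdist j (hj'.le.trans hrR), hij]
    have hpath := path_le_gradSq G f v r (fun i hi => hadj i (hi.trans_le hrR)) hinj
    have hgap : (ρ / 2) ^ 2 ≤ r * gradSq G f := by
      refine le_trans (pow_le_pow_left₀ (by positivity) ?_ 2) hpath
      rw [hv0]; linarith
    have hr' : (r : ℝ) * (δ ^ 2 * ρ) ≤ 12 := by
      have := mul_le_mul_of_nonneg_right hcount (show 0 ≤ 4 * δ by positivity)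
      rw [show 3 * (1 / δ) * (4 * δ) = 12 by field_simp; norm_num] at this
      linarith [show (r : ℝ) * (δ * (ρ / 4)) * (4 * δ) = r * (δ ^ 2 * ρ) by ring]
    have hg : 0 ≤ gradSq G f := sum_nonneg fun y _ => sum_nonneg fun z _ =>
      mul_nonneg (adjMatrix_nonneg G y z) (sq_nonneg _)
    have h1 : (ρ / 2) ^ 2 * (δ ^ 2 * ρ) ≤ 12 * gradSq G f :=
      calc (ρ / 2) ^ 2 * (δ ^ 2 * ρ) ≤ r * gradSq G f * (δ ^ 2 * ρ) :=
            mul_le_mul_of_nonneg_right hgap (by positivity)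
        _ = r * (δ ^ 2 * ρ) * gradSq G f := by ring
        _ ≤ 12 * gradSq G f := mul_le_mul_of_nonneg_right hr' hg
    linarith [show (ρ / 2) ^ 2 * (δ ^ 2 * ρ) = δ ^ 2 * ρ ^ 3 / 4 by ring]

end Nash

end LazyWalk

namespace LazyWalk

open Finset Matrix

/-! ### Dirichlet form and reversibility of the lazy walk. -/

section Chain

variable {V : Type*} [Fintype V] [DecidableEq V] (G : SimpleGraph V) [DecidableRel G.Adj]

theorem degree_mul_transitionMatrix {y : V} (hy : (0 : ℝ) < G.degree y) (z : V) :
    G.degree y * transitionMatrix G y z =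
      ((if y = z then (G.degree y : ℝ) else 0) + G.adjMatrix ℝ y z) / 2 := by
  rw [transitionMatrix, Matrix.of_apply, SimpleGraph.adjMatrix_apply]
  by_cases h : z = y
  · subst h; simp; ring
  · rw [if_neg h, if_neg (Ne.symm h)]
    split_ifs
    · field_simp; ring
    · simp

variable {G} (hdeg : ∀ y, (0 : ℝ) < G.degree y)
include hdeg

theorem degree_mul_mulVec (f : V → ℝ) (y : V) :
    G.degree y * (transitionMatrix G *ᵥ f) y =
      (G.degree y * f y + ∑ z, G.adjMatrix ℝ y z * f z) / 2 := by
  rw [Matrix.mulVec, dotProduct, mul_sum]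
  simp_rw [← mul_assoc, degree_mul_transitionMatrix G (hdeg y)]
  simp_rw [div_mul_eq_mul_div, add_mul, ite_mul, zero_mul]
  rw [← sum_div, sum_add_distrib]
  simp

/-- The Dirichlet form of the lazy walk. -/
theorem sum_degree_mul_sub_mulVec (f : V → ℝ) :
    ∑ y, G.degree y * (f y * (f y - (transitionMatrix G *ᵥ f) y)) = gradSq G f / 4 := by
  have h2 : gradSq G f = ∑ y, (G.degree y * f y ^ 2 -
      2 * (f y * ∑ z, G.adjMatrix ℝ y z * f z)) + ∑ y, ∑ z, G.adjMatrix ℝ y z * f z ^ 2 := by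
    rw [gradSq, ← sum_add_distrib]
    refine sum_congr rfl fun y _ => ?_
    rw [← sum_adjMatrix, sum_mul, mul_sum, mul_sum, ← sum_sub_distrib, ← sum_add_distrib]
    exact sum_congr rfl fun z _ => by ring
  rw [h2, sum_adjMatrix_mul_sq, ← sum_add_distrib, sum_div]
  refine sum_congr rfl fun y _ => ?_
  have := degree_mul_mulVec hdeg f y
  linear_combination (-f y) * this

/-- Laziness makes the transition operator positive semidefinite. -/
theorem sum_degree_mul_mulVec_nonneg (f : V → ℝ) :
    0 ≤ ∑ y, G.degree y * (f y * (transitionMatrix G *ᵥ f) y) := by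
  have h2 : ∑ y, ∑ z, G.adjMatrix ℝ y z * (f y + f z) ^ 2 = ∑ y, (G.degree y * f y ^ 2 +
      2 * (f y * ∑ z, G.adjMatrix ℝ y z * f z)) + ∑ y, ∑ z, G.adjMatrix ℝ y z * f z ^ 2 := by
    rw [← sum_add_distrib]
    refine sum_congr rfl fun y _ => ?_
    rw [← sum_adjMatrix, sum_mul, mul_sum, mul_sum, ← sum_add_distrib, ← sum_add_distrib]
    exact sum_congr rfl fun z _ => by ring
  have h3 : ∑ y, G.degree y * (f y * (transitionMatrix G *ᵥ f) y) =
      (∑ y, ∑ z, G.adjMatrix ℝ y z * (f y + f z) ^ 2) / 4 := by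
    rw [h2, sum_adjMatrix_mul_sq, ← sum_add_distrib, sum_div]
    refine sum_congr rfl fun y _ => ?_
    have := degree_mul_mulVec hdeg f y
    linear_combination (f y) * this
  rw [h3]
  exact div_nonneg (sum_nonneg fun y _ => sum_nonneg fun z _ =>
    mul_nonneg (adjMatrix_nonneg G y z) (sq_nonneg _)) (by norm_num)

theorem transitionMatrix_mulVec_one : transitionMatrix G *ᵥ 1 = 1 := by
  ext y
  have h := degree_mul_mulVec hdeg 1 y
  simp only [Pi.one_apply, mul_one, sum_adjMatrix] at h
  refine mul_left_cancel₀ (hdeg y).ne' ?_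
  rw [h]; simp

theorem sum_transitionMatrix_pow (t : ℕ) (y : V) : ∑ z, (transitionMatrix G ^ t) y z = 1 := by
  have h : transitionMatrix G ^ t *ᵥ 1 = 1 := by
    induction t with
    | zero => simp
    | succ t ih => rw [pow_succ, ← mulVec_mulVec, transitionMatrix_mulVec_one hdeg, ih]
  simpa [mulVec, dotProduct] using congrFun h y

omit hdeg in
theorem transitionMatrix_pow_nonneg (t : ℕ) (y z : V) : 0 ≤ (transitionMatrix G ^ t) y z := by
  induction t generalizing y with
  | zero => rw [pow_zero, one_apply]; split_ifs <;> norm_num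
  | succ t ih =>
    rw [pow_succ', mul_apply]
    refine sum_nonneg fun w _ => mul_nonneg ?_ (ih w)
    rw [transitionMatrix, of_apply]
    split_ifs <;> positivity

theorem transitionMatrix_reversible (t : ℕ) (y z : V) :
    G.degree y * (transitionMatrix G ^ t) y z = G.degree z * (transitionMatrix G ^ t) z y := by
  have h : SemiconjBy (diagonal fun y => (G.degree y : ℝ)) (transitionMatrix G)
      (transitionMatrix G)ᵀ := by
    ext y z
    rw [diagonal_mul, mul_diagonal, transpose_apply, mul_comm _ (G.degree z : ℝ),
      degree_mul_transitionMatrix G (hdeg y), degree_mul_transitionMatrix G (hdeg z),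
      adjMatrix_comm G y z]
    by_cases hyz : y = z
    · subst hyz; rfl
    · rw [if_neg hyz, if_neg (Ne.symm hyz)]
  have := congrFun (congrFun (h.pow_right t) y) z
  rw [← transpose_pow, diagonal_mul, mul_diagonal, transpose_apply] at this
  rw [this, mul_comm]

end Chain

/-! ### Centred densities and decrements of the return probability. -/

section ReturnProfile

variable {V : Type*} [Fintype V] [DecidableEq V] (G : SimpleGraph V) [DecidableRel G.Adj]

/-- The centred density of the walk started at `x`, with respect to the degree measure. -/
noncomputable def centredDensity (x : V) (t : ℕ) (y : V) : ℝ :=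
  (transitionMatrix G ^ t) y x / G.degree x - 1 / ∑ z, (G.degree z : ℝ)

variable {G} (hdeg : ∀ y, (0 : ℝ) < G.degree y)
include hdeg

omit [DecidableEq V] in
theorem sum_degree_pos (x : V) : (0 : ℝ) < ∑ z, (G.degree z : ℝ) :=
  sum_pos (fun z _ => hdeg z) ⟨x, mem_univ x⟩

theorem mulVec_centredDensity (x : V) (t : ℕ) :
    transitionMatrix G *ᵥ centredDensity G x t = centredDensity G x (t + 1) := by
  ext y
  simp only [mulVec, dotProduct, centredDensity, mul_sub, sum_sub_distrib]
  rw [← sum_mul]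
  have h := sum_transitionMatrix_pow hdeg 1 y
  rw [pow_one] at h
  rw [h, one_mul, pow_succ', mul_apply, sum_div]
  simp_rw [mul_div_assoc]

theorem sum_degree_mul_pow (x : V) (t : ℕ) :
    ∑ y, G.degree y * (transitionMatrix G ^ t) y x = G.degree x := by
  simp_rw [fun y => transitionMatrix_reversible hdeg t y x]
  rw [← mul_sum, sum_transitionMatrix_pow hdeg, mul_one]

theorem sum_degree_mul_centredDensity (x : V) (t : ℕ) :
    ∑ y, G.degree y * centredDensity G x t y = 0 := by
  have hv := sum_degree_pos hdeg x
  simp only [centredDensity, mul_sub, sum_sub_distrib, ← mul_div_assoc]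
  rw [← sum_div, ← sum_div, sum_degree_mul_pow hdeg]
  simp [(hdeg x).ne', hv.ne']

/-- Reversibility turns the degree-weighted product of two transition probabilities into a step of
Chapman–Kolmogorov through y; centring removes the constant terms. -/
theorem sum_degree_mul_centredDensity_mul (x : V) (s t : ℕ) :
    ∑ y, G.degree y * (centredDensity G x s y * centredDensity G x t y) =
      centredDensity G x (s + t) x := by
  have hx := (hdeg x).ne'
  have h0 := sum_degree_mul_centredDensity hdeg x s
  have h1 : ∀ y, G.degree y * (centredDensity G x s y * centredDensity G x t y) =
      (transitionMatrix G ^ s) x y * (transitionMatrix G ^ t) y x / G.degree x -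
      1 / (∑ z, (G.degree z : ℝ)) / G.degree x *
        (G.degree y * (transitionMatrix G ^ t) y x) -
      1 / (∑ z, (G.degree z : ℝ)) * (G.degree y * centredDensity G x s y) := by
    intro y
    have := transitionMatrix_reversible hdeg s x y
    rw [← mul_right_inj' hx]
    simp only [centredDensity]
    field_simp
    linear_combination (-(transitionMatrix G ^ t) y x) * this
  simp_rw [h1]
  rw [sum_sub_distrib, sum_sub_distrib, ← mul_sum, ← mul_sum, h0, sum_degree_mul_pow hdeg,
    ← sum_div, ← mul_apply, ← pow_add, centredDensity]
  field_simp
  ring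

theorem centredDensity_sub_succ (x : V) (s : ℕ) :
    centredDensity G x (2 * s) x - centredDensity G x (2 * s + 1) x =
      gradSq G (centredDensity G x s) / 4 := by
  rw [← sum_degree_mul_sub_mulVec hdeg, mulVec_centredDensity hdeg]
  simp_rw [mul_sub]
  rw [sum_sub_distrib, sum_degree_mul_centredDensity_mul hdeg,
    sum_degree_mul_centredDensity_mul hdeg, two_mul, add_assoc]

omit [DecidableEq V] hdeg in
theorem stationary_eq (x : V) : stationary G x = G.degree x / ∑ z, (G.degree z : ℝ) := by
  have : (Fintype.card V : ℝ) ≠ 0 := by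
    have : 0 < Fintype.card V := Fintype.card_pos_iff.2 ⟨x⟩
    positivity
  rw [stationary, avgDegree, div_mul_cancel₀ _ this]

theorem degree_mul_centredDensity (x : V) (t : ℕ) :
    G.degree x * centredDensity G x t x = (transitionMatrix G ^ t) x x - stationary G x := by
  have hx := (hdeg x).ne'
  rw [stationary_eq, centredDensity]
  field_simp

theorem sum_degree_mul_posPart_centredDensity_le (x : V) (t : ℕ) :
    ∑ z, G.degree z * max (centredDensity G x t z) 0 ≤ 1 := by
  have hv := sum_degree_pos hdeg x
  calc ∑ z, G.degree z * max (centredDensity G x t z) 0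
      ≤ ∑ z, G.degree z * ((transitionMatrix G ^ t) z x / G.degree x) := by
        refine sum_le_sum fun z _ => mul_le_mul_of_nonneg_left (max_le ?_ ?_) (hdeg z).le
        · rw [centredDensity]
          linarith [show 0 ≤ 1 / ∑ z, (G.degree z : ℝ) by positivity]
        · exact div_nonneg (transitionMatrix_pow_nonneg t z x) (hdeg x).le
    _ = 1 := by
        simp_rw [← mul_div_assoc]
        rw [← sum_div, sum_degree_mul_pow hdeg, div_self (hdeg x).ne']

theorem centredDensity_self_mul_le {δ : ℝ} (hδ : 0 ≤ δ) (x : V) (hx : δ ≤ G.degree x) (t : ℕ) :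
    δ * centredDensity G x t x ≤ 1 := by
  have hd := hdeg x
  have h1 := sum_degree_mul_posPart_centredDensity_le hdeg x t
  have h2 := Finset.single_le_sum (f := fun z => G.degree z * max (centredDensity G x t z) 0)
    (fun z _ => mul_nonneg (hdeg z).le (le_max_right _ _)) (mem_univ x)
  calc δ * centredDensity G x t x ≤ δ * max (centredDensity G x t x) 0 :=
        mul_le_mul_of_nonneg_left (le_max_left _ _) hδ
    _ ≤ G.degree x * max (centredDensity G x t x) 0 :=
        mul_le_mul_of_nonneg_right hx (le_max_right _ _)
    _ ≤ 1 := h2.trans h1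

/-- The density has degree-weighted mean zero, so it is nonpositive somewhere and the Nash
inequality applies. The constant is 200 = 4 · 50, the 4 coming from the Dirichlet form. -/
theorem centredDensity_decrement (hconn : G.Connected) {δ : ℝ} (hδ : 0 < δ)
    (hmin : ∀ z, δ ≤ G.degree z) (x : V) (s : ℕ) (hs : 0 < centredDensity G x s x) :
    δ ^ 2 * centredDensity G x s x ^ 3 / 200 ≤
      centredDensity G x (2 * s) x - centredDensity G x (2 * s + 1) x := by
  obtain ⟨y, hy⟩ : ∃ y, centredDensity G x s y ≤ 0 := by
    by_contra! hc
    have := sum_degree_mul_centredDensity hdeg x s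
    exact (sum_pos (fun z _ => mul_pos (hdeg z) (hc z)) ⟨x, mem_univ x⟩).ne' this
  have := nash_inequality hconn _ x y hs hy hδ hmin
    (sum_degree_mul_posPart_centredDensity_le hdeg x s)
    (centredDensity_self_mul_le hdeg hδ.le x (hmin x) s)
  rw [centredDensity_sub_succ hdeg]
  linarith

end ReturnProfile

end LazyWalk

namespace LazyWalk

open Finset Matrix

/-! ### Spectral decomposition via the symmetrized matrix. -/

section Spectral

variable {V : Type*} [Fintype V]

theorem eq_of_gradSq_eq_zero {G : SimpleGraph V} [DecidableRel G.Adj] (hconn : G.Connected)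
    {f : V → ℝ} (hf : gradSq G f = 0) (x y : V) : f x = f y := by
  have hnn : ∀ y z, 0 ≤ G.adjMatrix ℝ y z * (f y - f z) ^ 2 :=
    fun y z => mul_nonneg (adjMatrix_nonneg G y z) (sq_nonneg _)
  have hadj : ∀ y z, G.Adj y z → f y = f z := by
    intro y z hyz
    have h1 := (sum_eq_zero_iff_of_nonneg fun y _ => sum_nonneg fun z _ => hnn y z).1 hf y
      (mem_univ y)
    have h2 := (sum_eq_zero_iff_of_nonneg fun z _ => hnn y z).1 h1 z (mem_univ z)
    rw [SimpleGraph.adjMatrix_apply, if_pos hyz, one_mul] at h2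
    exact sub_eq_zero.1 (pow_eq_zero_iff two_ne_zero |>.1 h2)
  obtain ⟨p⟩ := hconn.preconnected x y
  induction p with
  | nil => rfl
  | cons h _ ih => exact (hadj _ _ h).trans ih

variable [DecidableEq V]

/-- Powers of a real symmetric matrix in terms of its eigenvectors. -/
theorem pow_apply_self_eq_sum {S : Matrix V V ℝ} (hS : S.IsHermitian) (t : ℕ) (x : V) :
    (S ^ t) x x = ∑ i, hS.eigenvalues i ^ t * hS.eigenvectorBasis i x ^ 2 := by
  conv_lhs => rw [hS.spectral_theorem, ← map_pow, diagonal_pow, Unitary.conjStarAlgAut_apply]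
  rw [mul_apply]
  refine sum_congr rfl fun i _ => ?_
  rw [mul_diagonal, star_apply, IsHermitian.eigenvectorUnitary_apply]
  simp
  ring

variable (G : SimpleGraph V) [DecidableRel G.Adj]

/-- The symmetrization of the transition matrix. -/
noncomputable def symmetrized : Matrix V V ℝ :=
  diagonal (fun y => √(G.degree y : ℝ)) * transitionMatrix G *
    diagonal (fun y => (√(G.degree y : ℝ))⁻¹)

theorem symmetrized_apply (y z : V) : symmetrized G y z =
    √(G.degree y : ℝ) * transitionMatrix G y z * (√(G.degree z : ℝ))⁻¹ := by
  rw [symmetrized, mul_diagonal, diagonal_mul]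

variable {G} (hdeg : ∀ y, (0 : ℝ) < G.degree y)
include hdeg

theorem diagonal_inv_sqrt_mul : diagonal (fun y => (√(G.degree y : ℝ))⁻¹) *
    diagonal (fun y => √(G.degree y : ℝ)) = 1 := by
  rw [diagonal_mul_diagonal, ← diagonal_one]
  congr 1; ext y
  exact inv_mul_cancel₀ (Real.sqrt_pos.2 (hdeg y)).ne'

theorem charpoly_symmetrized : (symmetrized G).charpoly = (transitionMatrix G).charpoly := by
  rw [symmetrized, charpoly_mul_comm, ← mul_assoc, diagonal_inv_sqrt_mul hdeg, one_mul]

theorem symmetrized_pow (t : ℕ) : symmetrized G ^ t =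
    diagonal (fun y => √(G.degree y : ℝ)) * transitionMatrix G ^ t *
      diagonal (fun y => (√(G.degree y : ℝ))⁻¹) := by
  have h1 := diagonal_inv_sqrt_mul hdeg
  induction t with
  | zero => rw [pow_zero, pow_zero, mul_one, mul_eq_one_comm.1 h1]
  | succ t ih =>
    rw [pow_succ, ih, symmetrized, pow_succ]
    simp only [← mul_assoc]
    rw [mul_assoc (_ * _) (diagonal _) (diagonal _), h1, mul_one]

theorem symmetrized_pow_apply_self (t : ℕ) (x : V) :
    (symmetrized G ^ t) x x = (transitionMatrix G ^ t) x x := by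
  have := (Real.sqrt_pos.2 (hdeg x)).ne'
  rw [symmetrized_pow hdeg, mul_diagonal, diagonal_mul]
  field_simp

theorem isHermitian_symmetrized : (symmetrized G).IsHermitian := by
  ext y z
  rw [conjTranspose_apply, star_trivial, symmetrized_apply, symmetrized_apply]
  have hy := (Real.sqrt_pos.2 (hdeg y)).ne'
  have hz := (Real.sqrt_pos.2 (hdeg z)).ne'
  have h := transitionMatrix_reversible hdeg 1 y z
  rw [pow_one, ← Real.sq_sqrt (hdeg y).le, ← Real.sq_sqrt (hdeg z).le] at h
  field_simp
  linear_combination -h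

theorem symmetrized_mulVec (f : V → ℝ) (y : V) :
    (symmetrized G *ᵥ fun z => √(G.degree z : ℝ) * f z) y =
      √(G.degree y : ℝ) * (transitionMatrix G *ᵥ f) y := by
  simp only [mulVec, dotProduct, mul_sum]
  refine sum_congr rfl fun z _ => ?_
  have hz := (Real.sqrt_pos.2 (hdeg z)).ne'
  rw [symmetrized_apply]
  field_simp

/-- An eigenvector of the symmetrized matrix gives an eigenfunction of the walk. -/
theorem exists_eigenfunction (i : V) : ∃ f : V → ℝ,
    (∀ y, (isHermitian_symmetrized hdeg).eigenvectorBasis i y = √(G.degree y : ℝ) * f y) ∧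
    (∀ y, (transitionMatrix G *ᵥ f) y = (isHermitian_symmetrized hdeg).eigenvalues i * f y) ∧
    ∑ y, G.degree y * f y ^ 2 = 1 := by
  set hS := isHermitian_symmetrized hdeg
  have hg : ∀ y, hS.eigenvectorBasis i y =
      √(G.degree y : ℝ) * ((√(G.degree y : ℝ))⁻¹ * hS.eigenvectorBasis i y) := fun y => by
    rw [mul_inv_cancel_left₀ (Real.sqrt_pos.2 (hdeg y)).ne']
  refine ⟨fun y => (√(G.degree y : ℝ))⁻¹ * hS.eigenvectorBasis i y, hg, fun y => ?_, ?_⟩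
  · have h := congrFun (hS.mulVec_eigenvectorBasis i) y
    have h2 := symmetrized_mulVec hdeg (fun y => (√(G.degree y : ℝ))⁻¹ * hS.eigenvectorBasis i y) y
    simp_rw [← hg] at h2
    rw [h2] at h
    refine mul_left_cancel₀ (Real.sqrt_pos.2 (hdeg y)).ne' ?_
    rw [h, Pi.smul_apply, smul_eq_mul]
    conv_lhs => rw [hg y]
    ring
  · have h := hS.eigenvectorBasis.orthonormal.1 i
    rw [EuclideanSpace.norm_eq, Real.sqrt_eq_one] at h
    rw [← h]
    refine sum_congr rfl fun y _ => ?_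
    have hy := (Real.sqrt_pos.2 (hdeg y)).ne'
    rw [mul_pow, inv_pow, Real.sq_sqrt (hdeg y).le, mul_inv_cancel_left₀ (hdeg y).ne',
      Real.norm_eq_abs, sq_abs]

theorem eigenvalues_nonneg (i : V) : 0 ≤ (isHermitian_symmetrized hdeg).eigenvalues i := by
  obtain ⟨f, -, hf, h1⟩ := exists_eigenfunction hdeg i
  have h := sum_degree_mul_mulVec_nonneg hdeg f
  simp_rw [hf] at h
  rw [← mul_one (IsHermitian.eigenvalues _ i), ← h1, mul_sum]
  exact h.trans_eq (sum_congr rfl fun y _ => by ring)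

theorem one_sub_eigenvalues (i : V) {f : V → ℝ}
    (hf : ∀ y, (transitionMatrix G *ᵥ f) y =
      (isHermitian_symmetrized hdeg).eigenvalues i * f y)
    (h1 : ∑ y, G.degree y * f y ^ 2 = 1) :
    1 - (isHermitian_symmetrized hdeg).eigenvalues i = gradSq G f / 4 := by
  rw [← sum_degree_mul_sub_mulVec hdeg]
  simp_rw [hf]
  rw [← mul_one (1 - IsHermitian.eigenvalues _ i)]
  calc (1 - IsHermitian.eigenvalues _ i) * 1
      = (1 - IsHermitian.eigenvalues _ i) * ∑ y, G.degree y * f y ^ 2 := by rw [h1]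
    _ = _ := by rw [mul_sum]; exact sum_congr rfl fun y _ => by ring

theorem eigenvalues_le_one (i : V) : (isHermitian_symmetrized hdeg).eigenvalues i ≤ 1 := by
  obtain ⟨f, -, hf, h1⟩ := exists_eigenfunction hdeg i
  have h := one_sub_eigenvalues hdeg i hf h1
  have : 0 ≤ gradSq G f := sum_nonneg fun y _ => sum_nonneg fun z _ =>
      mul_nonneg (adjMatrix_nonneg G y z) (sq_nonneg _)
  linarith

theorem exists_eigenvalues_eq_one [Nonempty V] :
    ∃ i, (isHermitian_symmetrized hdeg).eigenvalues i = 1 := by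
  change (1 : ℝ) ∈ Set.range _
  rw [← IsHermitian.spectrum_real_eq_range_eigenvalues, spectrum.mem_iff,
    Matrix.isUnit_iff_isUnit_det, isUnit_iff_ne_zero, not_not, ← exists_mulVec_eq_zero_iff]
  refine ⟨fun y => √(G.degree y : ℝ) * 1, fun h => ?_, ?_⟩
  · obtain ⟨y⟩ := ‹Nonempty V›
    have := congrFun h y
    rw [mul_one] at this
    exact (Real.sqrt_pos.2 (hdeg y)).ne' this
  · ext y
    have h := symmetrized_mulVec hdeg 1 y
    rw [transitionMatrix_mulVec_one hdeg] at h
    rw [map_one, sub_mulVec, one_mulVec, Pi.sub_apply, Pi.zero_apply, sub_eq_zero]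
    exact h.symm

/-- Eigenvectors of the symmetrized matrix at eigenvalue one are multiples of `√d`. -/
theorem eigenvectorBasis_of_eigenvalues_eq_one (hconn : G.Connected) {i : V}
    (hi : (isHermitian_symmetrized hdeg).eigenvalues i = 1) :
    ∃ c : ℝ, c ^ 2 * (∑ y, (G.degree y : ℝ)) = 1 ∧
      ∀ y, (isHermitian_symmetrized hdeg).eigenvectorBasis i y = √(G.degree y : ℝ) * c := by
  obtain ⟨f, hg, hf, h1⟩ := exists_eigenfunction hdeg i
  have h := one_sub_eigenvalues hdeg i hf h1
  have h0 : gradSq G f = 0 := by rw [hi] at h; linarith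
  have hc : ∀ y, f y = f i := fun y => eq_of_gradSq_eq_zero hconn h0 y i
  refine ⟨f i, ?_, fun y => by rw [hg, hc]⟩
  simp_rw [hc] at h1
  rw [← sum_mul, mul_comm] at h1
  exact h1

/-- Two such eigenvectors would both be nonzero multiples of √d, contradicting orthogonality. This
is where connectedness yields λ₂ < 1. -/
theorem eigenvalues_eq_one_unique (hconn : G.Connected) {i j : V}
    (hi : (isHermitian_symmetrized hdeg).eigenvalues i = 1)
    (hj : (isHermitian_symmetrized hdeg).eigenvalues j = 1) : i = j := by
  by_contra hij
  obtain ⟨c, hc, hgc⟩ := eigenvectorBasis_of_eigenvalues_eq_one hdeg hconn hi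
  obtain ⟨e, he, hge⟩ := eigenvectorBasis_of_eigenvalues_eq_one hdeg hconn hj
  have h := (isHermitian_symmetrized hdeg).eigenvectorBasis.orthonormal.2 hij
  beta_reduce at h
  rw [PiLp.inner_apply] at h
  simp_rw [hgc, hge] at h
  have h2 : c * e * ∑ y, (G.degree y : ℝ) = 0 := by
    rw [← h, mul_sum]
    refine sum_congr rfl fun y _ => ?_
    simp only [RCLike.inner_apply, conj_trivial]
    linear_combination (-(c * e)) * Real.sq_sqrt (hdeg y).le
  have h3 : (c ^ 2 * ∑ y, (G.degree y : ℝ)) * (e ^ 2 * ∑ y, (G.degree y : ℝ)) = 0 := by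
    linear_combination (c * e * ∑ y, (G.degree y : ℝ)) * h2
  rw [hc, he] at h3
  norm_num at h3

/-- Similar matrices share a characteristic polynomial, whose sorted roots are the ordered
eigenvalues; with at least two vertices the default value of `getD` is not reached. -/
theorem lambdaTwo_eq (hn : 1 < Fintype.card V) : lambdaTwo (transitionMatrix G) =
    (isHermitian_symmetrized hdeg).eigenvalues₀ ⟨1, hn⟩ := by
  have h := (isHermitian_symmetrized hdeg).sort_roots_charpoly_eq_eigenvalues₀
  rw [charpoly_symmetrized hdeg] at h
  have h2 : (transitionMatrix G).charpoly.roots.map (RCLike.re : ℝ → ℝ) =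
      (transitionMatrix G).charpoly.roots := by
    conv_rhs => rw [← Multiset.map_id (transitionMatrix G).charpoly.roots]
    rfl
  rw [h2] at h
  rw [lambdaTwo, eigenvalueList, h, List.getD_eq_getElem?_getD, List.getElem?_ofFn]
  simp [hn]

/-- Spectral decomposition of the return probabilities. -/
theorem exists_spectral_return (hconn : G.Connected) (hn : 1 < Fintype.card V) (x : V) :
    lambdaTwo (transitionMatrix G) < 1 ∧ 0 ≤ lambdaTwo (transitionMatrix G) ∧
    ∃ μ w : V → ℝ, (∀ i, 0 ≤ w i) ∧ (∀ i, 0 ≤ μ i) ∧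
      (∀ i, μ i ≤ lambdaTwo (transitionMatrix G)) ∧
      ∀ t : ℕ, (transitionMatrix G ^ t) x x - stationary G x = ∑ i, μ i ^ t * w i := by
  set hS := isHermitian_symmetrized hdeg
  set e : Fin (Fintype.card V) ≃ V := Fintype.equivOfCardEq (Fintype.card_fin _)
  have hev : ∀ i, hS.eigenvalues i = hS.eigenvalues₀ (e.symm i) := fun i => rfl
  have : Nonempty V := ⟨x⟩
  obtain ⟨o, ho⟩ := exists_eigenvalues_eq_one hdeg
  have huniq : ∀ j, j ≠ o → hS.eigenvalues j < 1 := fun j hj =>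
    lt_of_le_of_ne (eigenvalues_le_one hdeg j)
      fun h => hj (eigenvalues_eq_one_unique hdeg hconn h ho)
  have hzero : o = e ⟨0, by omega⟩ := by
    by_contra hne
    have h1 := huniq _ (Ne.symm hne)
    have h2 : hS.eigenvalues o ≤ hS.eigenvalues (e ⟨0, by omega⟩) := by
      rw [hev, hev, Equiv.symm_apply_apply]
      exact hS.eigenvalues₀_antitone (Fin.mk_le_of_le_val (Nat.zero_le _))
    rw [ho] at h2
    linarith
  have htwo : lambdaTwo (transitionMatrix G) = hS.eigenvalues (e ⟨1, hn⟩) := by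
    rw [lambdaTwo_eq hdeg hn, hev, Equiv.symm_apply_apply]
  have hle : ∀ j, j ≠ o → hS.eigenvalues j ≤ lambdaTwo (transitionMatrix G) := by
    intro j hj
    rw [lambdaTwo_eq hdeg hn, hev]
    refine hS.eigenvalues₀_antitone (Fin.mk_le_of_le_val ?_)
    rw [Nat.one_le_iff_ne_zero]
    intro h0
    exact hj (by rw [hzero, ← e.symm_apply_eq]; exact Fin.ext h0)
  have hl0 : 0 ≤ lambdaTwo (transitionMatrix G) := htwo ▸ eigenvalues_nonneg hdeg _
  -- The top mode o contributes exactly π(x) and is removed. Setting its μ to 0 keeps μ ≤ λ₂;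
  -- setting its weight to 0 also handles 0 ^ 0 at t = 0.
  refine ⟨?_, hl0, fun i => if i = o then 0 else hS.eigenvalues i,
    fun i => if i = o then 0 else hS.eigenvectorBasis i x ^ 2, fun i => ?_, fun i => ?_,
    fun i => ?_, fun t => ?_⟩
  · rw [htwo]
    refine huniq _ ?_
    rw [hzero]
    exact e.injective.ne (by simp)
  · dsimp only; split_ifs <;> positivity
  · dsimp only; split_ifs
    exacts [le_rfl, eigenvalues_nonneg hdeg i]
  · dsimp only; split_ifs with h
    exacts [hl0, hle i h]
  · have hst : hS.eigenvectorBasis o x ^ 2 = stationary G x := by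
      obtain ⟨c, hc, hg⟩ := eigenvectorBasis_of_eigenvalues_eq_one hdeg hconn ho
      rw [hg, mul_pow, Real.sq_sqrt (hdeg x).le, stationary_eq,
        eq_div_iff (sum_degree_pos hdeg x).ne', mul_assoc, hc, mul_one]
    rw [← symmetrized_pow_apply_self hdeg, pow_apply_self_eq_sum hS,
      ← add_sum_erase _ _ (mem_univ o), ← add_sum_erase (a := o) _ _ (mem_univ o), ho, hst]
    simp only [one_pow, one_mul, if_true, mul_zero, zero_add, add_sub_cancel_left]
    refine sum_congr rfl fun i hi => ?_
    rw [if_neg (ne_of_mem_erase hi), if_neg (ne_of_mem_erase hi)]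

end Spectral

end LazyWalk

namespace LazyWalk

open Finset Matrix

/-! ### From decrements and spectral decay to explicit bounds. -/

section Bounds

/-- Discrete form of h' = -h³/200: while h is positive, each step raises 1/h² by at least 1/100. -/
theorem le_ten_div_sqrt_of_cubic_decrement {h : ℕ → ℝ} (h0 : h 0 ≤ 1) (hnn : ∀ n, 0 ≤ h n)
    (hstep : ∀ n, h n ^ 3 / 200 ≤ h n - h (n + 1)) (n : ℕ) :
    h n ≤ 10 / √((n : ℝ) + 1) := by
  have key : h n ^ 2 * ((n : ℝ) + 1) ≤ 100 := by
    induction n with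
    | zero => have := hnn 0; norm_num; nlinarith
    | succ n ih =>
      push_cast
      have hp := hnn (n + 1)
      have hs := hstep n
      rcases (hnn n).eq_or_lt with hz | hz
      · rw [← hz] at hs
        have : h (n + 1) = 0 := by linarith [hs, hp]
        rw [this]; norm_num
      · set a := h n
        set b := h (n + 1)
        have hb : b ≤ a * (1 - a ^ 2 / 200) := by linarith
        have hq : 0 ≤ 1 - a ^ 2 / 200 := by
          by_contra hc
          linarith [mul_neg_of_pos_of_neg hz (not_le.1 hc)]
        have hb2 : b ^ 2 ≤ a ^ 2 * (1 - a ^ 2 / 200) ^ 2 := by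
          rw [← mul_pow]; exact pow_le_pow_left₀ hp hb 2
        have hy : 0 < a ^ 2 := by positivity
        set y := a ^ 2
        -- The left side expands to 100 - 3y²/400 + y³/40000, and y ≤ 200.
        have h1 : (1 - y / 200) ^ 2 * (100 + y) ≤ 100 := by
          nlinarith [mul_nonneg hq (sq_nonneg y), sq_nonneg y]
        have h2 : b ^ 2 * (100 + y) ≤ 100 * y := by
          calc b ^ 2 * (100 + y) ≤ y * (1 - y / 200) ^ 2 * (100 + y) :=
                mul_le_mul_of_nonneg_right hb2 (by positivity)
            _ = y * ((1 - y / 200) ^ 2 * (100 + y)) := by ring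
            _ ≤ y * 100 := mul_le_mul_of_nonneg_left h1 hy.le
            _ = 100 * y := by ring
        have h3 := mul_le_mul_of_nonneg_left ih (sq_nonneg b)
        refine le_of_mul_le_mul_left ?_ hy
        linarith [show y * (b ^ 2 * ((n : ℝ) + 1 + 1)) = b ^ 2 * (y * ((n : ℝ) + 1)) + b ^ 2 * y
          by ring]
  have hp : (0 : ℝ) < (n : ℝ) + 1 := by positivity
  rw [le_div_iff₀ (Real.sqrt_pos.2 hp)]
  refine abs_le_of_sq_le_sq' ?_ (by norm_num) |>.2
  rw [mul_pow, Real.sq_sqrt hp.le]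
  linarith

/-- Geometric decay at rate `1 - 1 / T` turns a `1 / √t` bound into a `√T / t` bound. -/
theorem le_sqrt_div_of_geometric_decay {b : ℕ → ℝ} {l C : ℝ} (hl0 : 0 ≤ l) (hl1 : l < 1)
    (hC : 0 ≤ C) (hdecay : ∀ n, b (n + 1) ≤ l * b n)
    (hb : ∀ n : ℕ, b n ≤ C * (1 / √((n : ℝ) + 1))) (t : ℕ) :
    b t ≤ C * (√((1 - l)⁻¹ + 1) / ((t : ℝ) + 1)) := by
  set T := (1 - l)⁻¹ with hT
  have hl : 0 < 1 - l := by linarith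
  have hTpos : 0 < T := inv_pos.2 hl
  have hlT : l = 1 - 1 / T := by rw [hT, one_div, inv_inv]; ring
  have ht : (0 : ℝ) < (t : ℝ) + 1 := by positivity
  -- Up to time T the hypothesis `hb` already suffices; beyond it, decay starts from s = ⌊T⌋.
  rcases le_or_gt (t : ℝ) T with h | h
  · refine (hb t).trans (mul_le_mul_of_nonneg_left ?_ hC)
    rw [div_le_div_iff₀ (Real.sqrt_pos.2 ht) ht, one_mul]
    calc (t : ℝ) + 1 = √((t : ℝ) + 1) * √((t : ℝ) + 1) := (Real.mul_self_sqrt ht.le).symm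
      _ ≤ √(T + 1) * √((t : ℝ) + 1) :=
        mul_le_mul_of_nonneg_right (Real.sqrt_le_sqrt (by linarith)) (Real.sqrt_nonneg _)
  · obtain ⟨k, hk⟩ : ∃ k, t = ⌊T⌋₊ + k :=
      Nat.exists_eq_add_of_le (Nat.cast_le.1 ((Nat.floor_le hTpos.le).trans h.le))
    set s := ⌊T⌋₊
    have hs1 : (s : ℝ) ≤ T := Nat.floor_le hTpos.le
    have hs2 : T < s + 1 := Nat.lt_floor_add_one T
    have hpow : b (s + k) ≤ l ^ k * b s := by
      clear hk
      induction k with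
      | zero => simp
      | succ k ih =>
        rw [pow_succ', mul_assoc]
        exact (hdecay (s + k)).trans (mul_le_mul_of_nonneg_left ih hl0)
    -- Bernoulli's inequality, together with (1 - 1/T)(1 + 1/T) ≤ 1.
    have hlk : l ^ k * (1 + k / T) ≤ 1 := by
      calc l ^ k * (1 + k / T) ≤ l ^ k * (1 + 1 / T) ^ k := by
            refine mul_le_mul_of_nonneg_left ?_ (pow_nonneg hl0 k)
            have := one_add_mul_le_pow (a := 1 / T)
              (by linarith [show 0 < 1 / T by positivity]) k
            rwa [mul_one_div] at this
        _ = (l * (1 + 1 / T)) ^ k := (mul_pow _ _ _).symm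
        _ ≤ 1 := by
            refine pow_le_one₀ (mul_nonneg hl0 (by positivity)) ?_
            rw [hlT]
            nlinarith [sq_nonneg (1 / T)]
    have hs : (0 : ℝ) < (s : ℝ) + 1 := by positivity
    set A := √(T + 1) with hA
    set B := √((s : ℝ) + 1) with hB
    have hA2 : A ^ 2 = T + 1 := Real.sq_sqrt (by positivity)
    have hB2 : B ^ 2 = s + 1 := Real.sq_sqrt hs.le
    have hBpos : 0 < B := Real.sqrt_pos.2 hs
    have hBA : B ≤ A := Real.sqrt_le_sqrt (by linarith)
    have hAB : (s : ℝ) + 1 ≤ A * B := by nlinarith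
    -- Both s + 1 and T are at most AB, so t + 1 = (s + 1) + k ≤ AB + AB · k/T.
    have hlow : (t : ℝ) + 1 ≤ A * B * (1 + k / T) := by
      have h1 : (k : ℝ) ≤ A * B * (k / T) := by
        rw [← mul_div_assoc, le_div_iff₀ hTpos, mul_comm]
        exact mul_le_mul_of_nonneg_right (by linarith) (Nat.cast_nonneg k)
      rw [hk]; push_cast; linarith
    rw [hk] at hlow ht ⊢
    refine hpow.trans ((mul_le_mul_of_nonneg_left (hb s) (pow_nonneg hl0 k)).trans ?_)
    rw [mul_left_comm]
    refine mul_le_mul_of_nonneg_left ?_ hC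
    rw [mul_one_div, div_le_div_iff₀ hBpos ht]
    calc l ^ k * (((s + k : ℕ) : ℝ) + 1) ≤ l ^ k * (A * B * (1 + k / T)) :=
          mul_le_mul_of_nonneg_left hlow (pow_nonneg hl0 k)
      _ = A * B * (l ^ k * (1 + k / T)) := by ring
      _ ≤ A * B * 1 := mul_le_mul_of_nonneg_left hlk (by positivity)
      _ = A * B := mul_one _

variable {V : Type*} [Fintype V] [DecidableEq V] {G : SimpleGraph V} [DecidableRel G.Adj]

theorem return_sub_stationary_le (hconn : G.Connected) (hn : 1 < Fintype.card V) {δ : ℝ}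
    (hδ : 0 < δ) (hmin : ∀ z, δ ≤ G.degree z) (x : V) (t : ℕ) :
    (transitionMatrix G ^ t) x x - stationary G x ≤
      10 * G.degree x / δ * (1 / √((t : ℝ) + 1)) := by
  have hdeg : ∀ y, (0 : ℝ) < G.degree y := fun y => hδ.trans_le (hmin y)
  obtain ⟨hl1, hl0, μ, w, hw, hμ0, hμl, hsum⟩ := exists_spectral_return hdeg hconn hn x
  have hμ1 : ∀ i, μ i ≤ 1 := fun i => (hμl i).trans hl1.le
  set a : ℕ → ℝ := fun n => centredDensity G x n x with ha
  have had : ∀ n, a n = (∑ i, μ i ^ n * w i) / G.degree x := fun n => by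
    rw [eq_div_iff (hdeg x).ne', mul_comm, ← hsum, ← degree_mul_centredDensity hdeg]
  have hnn : ∀ n, 0 ≤ a n := fun n => by
    rw [had]
    exact div_nonneg (sum_nonneg fun i _ => mul_nonneg (pow_nonneg (hμ0 i) n) (hw i)) (hdeg x).le
  have hanti : Antitone a := antitone_nat_of_succ_le fun n => by
    rw [had, had]
    refine div_le_div_of_nonneg_right (sum_le_sum fun i _ => ?_) (hdeg x).le
    exact mul_le_mul_of_nonneg_right (pow_le_pow_of_le_one (hμ0 i) (hμ1 i) n.le_succ) (hw i)
  have hconv : ∀ n, a (n + 1) - a (n + 2) ≤ a n - a (n + 1) := fun n => by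
    rw [had, had, had, ← sub_div, ← sub_div, ← sum_sub_distrib, ← sum_sub_distrib]
    refine div_le_div_of_nonneg_right (sum_le_sum fun i _ => ?_) (hdeg x).le
    have := mul_nonneg (mul_nonneg (pow_nonneg (hμ0 i) n) (sq_nonneg (1 - μ i))) (hw i)
    linarith [show μ i ^ n * (1 - μ i) ^ 2 * w i = μ i ^ n * w i - μ i ^ (n + 1) * w i -
      (μ i ^ (n + 1) * w i - μ i ^ (n + 2) * w i) by ring]
  -- Monotonicity replaces a(s) by the smaller a(n) in the cube, so it suffices to compare the
  -- decrement at n with the one at 2s.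
  have hcube : ∀ n s, s ≤ n → a (2 * s) - a (2 * s + 1) ≤ a n - a (n + 1) →
      (δ * a n) ^ 3 / 200 ≤ δ * a n - δ * a (n + 1) := by
    intro n s hsn hs
    rcases (hnn n).eq_or_lt with hz | hz
    · have := hanti n.le_succ
      rw [← hz] at this ⊢
      have h0 : a (n + 1) = 0 := le_antisymm this (hnn _)
      rw [h0]; norm_num
    · have h1 := centredDensity_decrement hdeg hconn hδ hmin x s (hz.trans_le (hanti hsn))
      have h2 : a n ^ 3 ≤ a s ^ 3 := pow_le_pow_left₀ hz.le (hanti hsn) 3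
      have h3 : δ ^ 2 * a n ^ 3 ≤ δ ^ 2 * a s ^ 3 :=
        mul_le_mul_of_nonneg_left h2 (by positivity)
      have h4 : δ ^ 2 * a n ^ 3 / 200 ≤ a n - a (n + 1) := by
        refine le_trans ?_ (h1.trans hs)
        exact div_le_div_of_nonneg_right h3 (by norm_num)
      have := mul_le_mul_of_nonneg_left h4 hδ.le
      linarith [show (δ * a n) ^ 3 / 200 = δ * (δ ^ 2 * a n ^ 3 / 200) by ring]
  have hstep : ∀ n, (δ * a n) ^ 3 / 200 ≤ δ * a n - δ * a (n + 1) := by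
    intro n
    -- For odd n = 2s + 1, convexity bounds the decrement below by the one at the even time n + 1 =
    -- 2(s + 1).
    rcases Nat.even_or_odd' n with ⟨s, rfl | rfl⟩
    · exact hcube _ s (by omega) le_rfl
    · exact hcube _ (s + 1) (by omega) (hconv (2 * s + 1))
  have hmain := le_ten_div_sqrt_of_cubic_decrement (h := fun n => δ * a n)
    (centredDensity_self_mul_le hdeg hδ.le x (hmin x) 0)
    (fun n => mul_nonneg hδ.le (hnn n)) hstep t
  rw [← degree_mul_centredDensity hdeg]
  have h2 := mul_le_mul_of_nonneg_left hmain (div_nonneg (hdeg x).le hδ.le)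
  calc G.degree x * a t = G.degree x / δ * (δ * a t) := by field_simp
    _ ≤ G.degree x / δ * (10 / √((t : ℝ) + 1)) := h2
    _ = _ := by ring

end Bounds

end LazyWalk

theorem mainTheorem4 {V : Type*} [Fintype V] [DecidableEq V]
    (G : SimpleGraph V) [DecidableRel G.Adj]
    (hconn : G.Connected) (hn : 2 ≤ Fintype.card V) (x : V) (t : ℕ) :
    (LazyWalk.transitionMatrix G ^ t) x x - LazyWalk.stationary G x ≤
      10 * (G.degree x : ℝ) / (G.minDegree : ℝ) *
        min (1 / √((t : ℝ) + 1))
          (√(LazyWalk.relaxationTime G + 1) / ((t : ℝ) + 1)) := by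
  have : Nontrivial V := Fintype.one_lt_card_iff_nontrivial.1 hn
  have hδ : (0 : ℝ) < G.minDegree :=
    Nat.cast_pos.2 hconn.preconnected.minDegree_pos_of_nontrivial
  have hmin : ∀ z, (G.minDegree : ℝ) ≤ G.degree z := fun z => Nat.cast_le.2 (G.minDegree_le_degree z)
  have hfirst := LazyWalk.return_sub_stationary_le hconn hn hδ hmin x
  have hC : 0 ≤ 10 * (G.degree x : ℝ) / (G.minDegree : ℝ) := by positivity
  obtain ⟨hl1, hl0, μ, w, hw, hμ0, hμl, hsum⟩ :=
    LazyWalk.exists_spectral_return (fun y => hδ.trans_le (hmin y)) hconn hn x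
  -- Each mode shrinks by its own μ ≤ λ₂, and all contributions are nonnegative.
  have hdecay : ∀ n, (LazyWalk.transitionMatrix G ^ (n + 1)) x x - LazyWalk.stationary G x ≤
      LazyWalk.lambdaTwo (LazyWalk.transitionMatrix G) *
        ((LazyWalk.transitionMatrix G ^ n) x x - LazyWalk.stationary G x) := by
    intro n
    rw [hsum, hsum, Finset.mul_sum]
    refine Finset.sum_le_sum fun i _ => ?_
    rw [pow_succ', mul_assoc]
    exact mul_le_mul_of_nonneg_right (hμl i) (mul_nonneg (pow_nonneg (hμ0 i) n) (hw i))
  rw [mul_min_of_nonneg _ _ hC]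
  exact le_min (hfirst t) (LazyWalk.le_sqrt_div_of_geometric_decay hl0 hl1 hC hdecay hfirst t)
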